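/- Let $G$ be a lattice-ordered group (not necessarily abelian) and $(W,+)$ an abelian semigroup with a right action of $G$ by semigroup automorphisms. Let $(\Phi,h)$ be a weighted gain graph: a graph with finite vertex set $V$ and edge set $E$, whose edges may be links, loops, half edges (one endpoint) or loose edges (no endpoint), together with a gain $\varphi(e)\in G$ for every link and loop (inverted when the direction of $e$ is reversed) and a weight function $h:V\to W$. Switching by $\eta:V\to G$ replaces a gain $\varphi(e)$ from $v$ to $w$ by $\eta(v)^{-1}\varphi(e)\eta(w)$ and $h(v)$ by $h(v)\eta(v)$; the switched weighted gain graph is $(\Phi^\eta,h^\eta)$. For $S\subseteq E$ let $\pi_b(S)$ be the set of vertex sets of the balanced components of $(V,S)$ (those without half edges in which every circle has gain $1$) and let $V_b(S)$ be their union. The top switching function $\eta_S$ is the unique function on $V_b(S)$ such that $\varphi^{\eta_S}=1$ on every link and loop of $S$ in a balanced component and $\bigwedge_{v\in X}\eta_S(v)=1$ for every $X\in\pi_b(S)$. The deletion $(\Phi,h)\setminus S$ deletes the edges of $S$. The contraction $(\Phi,h)/S$ has vertex set $\pi_b(S)$ and edge set $E\setminus S$; it is obtained by switching by $\eta_S$,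 deleting the vertices outside $V_b(S)$ (an edge not in $S$ loses its deleted endpoints but remains), identifying each $X\in\pi_b(S)$ to a single vertex, and deleting $S$. The weight of the vertex $X$ is $\sum_{v\in X}h(v)\eta_S(v)$. Let $S=Q\cup R\subseteq E$ with $Q\cap R=\varnothing$. Then: 1. $((\Phi,h)/Q)/R=(\Phi,h)/S$, where each vertex $X\in\pi_b(S)$ of the right side is identified with the vertex $X''=\{Y\in\pi_b(Q): Y\subseteq X\}$ of the left side, so that $X=\bigcup X''$; this correspondence is a bijection of the vertex sets. 2. $((\Phi,h)/Q)\setminus R=((\Phi,h)\setminus R)/Q$. 3. $((\Phi,h)\setminus Q)\setminus R=(\Phi,h)\setminus S$. 4. $\eta_S(v)=\eta_Q(v)\,\eta'_S(v)$ for every $v\in V_b(S)$, where $\eta'_S$ is the top switching function for $S$ in $\Phi^{\eta_Q}$. (In particular this holds on all of $V$ when $S$ is balanced.) -/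

import Mathlib

/-- The incidences and the gain of one edge with vertices in `V` and gains in `G`: a loose edge has no
endpoint, a half edge has one endpoint, and an ordinary edge (a loop or a link) has two endpoints, which
may coincide. An ordinary edge is written in one (arbitrary) reference direction `arc v w g`, from `v`
to `w` with gain `g`; it is the same undirected edge as the one from `w` to `v` with gain `g⁻¹`. -/
inductive EdgeData (V : Type*) (G : Type*) where
  | loose : EdgeData V G
  | half (v : V) : EdgeData V G
  | arc (v w : V) (g : G) : EdgeData V G

namespace EdgeData

/-- The set of endpoints. -/
def ends {V G : Type*} : EdgeData V G → Set V
  | loose => ∅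
  | half v => {v}
  | arc v w _ => {v, w}

/-- Renaming the vertices. -/
def map {V V' G : Type*} (f : V → V') : EdgeData V G → EdgeData V' G
  | loose => loose
  | half v => half (f v)
  | arc v w g => arc (f v) (f w) g

/-- Switching: the gain `g` from `v` to `w` becomes `η(v)⁻¹ g η(w)`. -/
def switch {V G : Type*} [Group G] (η : V → G) : EdgeData V G → EdgeData V G
  | loose => loose
  | half v => half v
  | arc v w g => arc v w ((η v)⁻¹ * g * η w)

/-- Every vertex `v` with `p v = some x` is identified to `x`, and every vertex with `p v = none` is
deleted; an edge loses its deleted endpoints but remains (as a half or loose edge). -/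
def collapse {V V' G : Type*} (p : V → Option V') : EdgeData V G → EdgeData V' G
  | loose => loose
  | half v =>
    match p v with
    | some x => half x
    | none => loose
  | arc v w g =>
    match p v, p w with
    | some x, some y => arc x y g
    | some x, none => half x
    | none, some y => half y
    | none, none => loose

end EdgeData

/-- A gain graph with vertex set `V`, edge set `E` and gain group `G`. -/
structure GainGraph (V : Type*) (E : Type*) (G : Type*) where
  edge : E → EdgeData V G

namespace GainGraph

variable {V E G : Type*}

/-- The ordinary edge `e` can be traversed from `v` to `w`, and its gain in this direction is `g`. -/
def Traverses [Group G] (Φ : GainGraph V E G) (e : E) (v w : V) (g : G) : Prop :=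
  Φ.edge e = EdgeData.arc v w g ∨ Φ.edge e = EdgeData.arc w v g⁻¹

/-- `Φ.IsWalk v w vs es g`: there is a walk from `v` to `w` with sequence of edges `es`, whose
vertices other than the final vertex `w` are in order `vs`, and whose gain (the product of the gains of
its edges in the direction of the walk) is `g`. -/
inductive IsWalk [Group G] (Φ : GainGraph V E G) : V → V → List V → List E → G → Prop
  | nil (v : V) : IsWalk Φ v v [] [] 1
  | cons {e : E} {u v w : V} {g g' : G} {vs : List V} {es : List E} :
      Φ.Traverses e u v g → IsWalk Φ v w vs es g' → IsWalk Φ u w (u :: vs) (e :: es) (g * g')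

/-- An edge set `T` is balanced if it contains no half edge and every circle in it has gain `1`.
A circle, run through from one of its vertices, is a closed walk of positive length without repeated
edges and without repeated vertices (other than the equality of the first and the last). -/
def IsBalanced [Group G] (Φ : GainGraph V E G) (T : Set E) : Prop :=
  (∀ e ∈ T, ∀ v, Φ.edge e ≠ EdgeData.half v) ∧
  ∀ (v : V) (vs : List V) (es : List E) (g : G), Φ.IsWalk v v vs es g →
    es ≠ [] → vs.Nodup → es.Nodup → (∀ e ∈ es, e ∈ T) → g = 1

/-- Two vertices are joined by an ordinary edge of `S`. -/
def Adj (Φ : GainGraph V E G) (S : Set E) (v w : V) : Prop :=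
  ∃ e ∈ S, ∃ g, Φ.edge e = EdgeData.arc v w g

/-- Connectedness of two vertices in the spanning subgraph `(V, S)`. -/
def conn (Φ : GainGraph V E G) (S : Set E) : Setoid V := Relation.EqvGen.setoid (Φ.Adj S)

/-- The vertex set of the component of `(V, S)` that contains `v`. -/
def part (Φ : GainGraph V E G) (S : Set E) (v : V) : Set V := {w | (Φ.conn S).r w v}

/-- The partition `π(S)` of `V` into the vertex sets of the components of `(V, S)`. -/
def parts (Φ : GainGraph V E G) (S : Set E) : Set (Set V) := (Φ.conn S).classes

/-- The induced part `S:W` of `S`: the edges in `S` that have an endpoint in `W` and no endpoint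
outside `W`. -/
def induced (Φ : GainGraph V E G) (S : Set E) (W : Set V) : Set E :=
  {e ∈ S | (Φ.edge e).ends.Nonempty ∧ (Φ.edge e).ends ⊆ W}

/-- `π_b(S)`: the vertex sets of the balanced components of `(V, S)`. -/
def balancedParts [Group G] (Φ : GainGraph V E G) (S : Set E) : Set (Set V) :=
  {W ∈ Φ.parts S | Φ.IsBalanced (Φ.induced S W)}

/-- `V_b(S)`: the set of vertices of the balanced components of `(V, S)`. -/
def balancedVerts [Group G] (Φ : GainGraph V E G) (S : Set E) : Set V := ⋃₀ Φ.balancedParts S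

/-- Switching a gain graph. -/
def switch [Group G] (Φ : GainGraph V E G) (η : V → G) : GainGraph V E G where
  edge e := (Φ.edge e).switch η

/-- Deleting the edge set `S`. -/
def delete (Φ : GainGraph V E G) (S : Set E) : GainGraph V {e // e ∉ S} G where
  edge e := Φ.edge e

/-- `η` is a top switching function for (the balanced components of) `S`: it switches all gains in
the balanced components of `S` to `1`, and the meet of its values on each `W ∈ π_b(S)` is `1`.
When `S` is not balanced, the vertices outside `V_b(S)` are irrelevant, and `η` has value `1` there. -/
structure IsTopSwitching [Group G] [Lattice G] (Φ : GainGraph V E G) (S : Set E) (η : V → G) :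
    Prop where
  switching : ∀ e ∈ S, ∀ v w g, Φ.edge e = EdgeData.arc v w g → v ∈ Φ.balancedVerts S →
    (η v)⁻¹ * g * η w = 1
  meet : ∀ W ∈ Φ.balancedParts S, IsGLB (η '' W) 1
  off : ∀ v ∉ Φ.balancedVerts S, η v = 1

section Existence

theorem mem_part_self (Φ : GainGraph V E G) (S : Set E) (v : V) : v ∈ Φ.part S v :=
  (Φ.conn S).refl v

theorem part_mem_parts (Φ : GainGraph V E G) (S : Set E) (v : V) : Φ.part S v ∈ Φ.parts S :=
  ⟨v, rfl⟩

theorem part_eq_of_mem {Φ : GainGraph V E G} {S : Set E} {W : Set V} {v : V}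
    (hW : W ∈ Φ.parts S) (hv : v ∈ W) : Φ.part S v = W :=
  Setoid.eq_of_mem_classes (part_mem_parts Φ S v) (mem_part_self Φ S v) hW hv

theorem nonempty_of_mem_parts {Φ : GainGraph V E G} {S : Set E} {W : Set V}
    (hW : W ∈ Φ.parts S) : W.Nonempty := by
  obtain ⟨y, rfl⟩ := hW
  exact ⟨y, (Φ.conn S).refl y⟩

theorem part_eq_of_arc {Φ : GainGraph V E G} {S : Set E} {e : E} {v w : V} {g : G}
    (he : e ∈ S) (h : Φ.edge e = EdgeData.arc v w g) : Φ.part S v = Φ.part S w :=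
  part_eq_of_mem (part_mem_parts Φ S w) (Relation.EqvGen.rel _ _ ⟨e, he, g, h⟩)

variable [Group G]

theorem Traverses.symm {Φ : GainGraph V E G} {e : E} {v w : V} {g : G} (h : Φ.Traverses e v w g) :
    Φ.Traverses e w v g⁻¹ := by
  rcases h with h | h
  · right; simpa using h
  · left; exact h

theorem Traverses.ends {Φ : GainGraph V E G} {e : E} {v w : V} {g : G} (h : Φ.Traverses e v w g) :
    (Φ.edge e).ends = {v, w} := by
  rcases h with h | h
  · rw [h]; rfl
  · rw [h]; exact Set.pair_comm _ _

theorem IsWalk.append {Φ : GainGraph V E G} {u v : V} {vs : List V} {es : List E} {g : G}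
    (h : Φ.IsWalk u v vs es g) : ∀ {w : V} {vs' : List V} {es' : List E} {g' : G},
    Φ.IsWalk v w vs' es' g' → Φ.IsWalk u w (vs ++ vs') (es ++ es') (g * g') := by
  induction h with
  | nil v => intro w vs' es' g' h'; simpa using h'
  | cons ht _ ih => intro w vs' es' g' h'; rw [mul_assoc]; exact IsWalk.cons ht (ih h')

theorem IsWalk.ends_mem {Φ : GainGraph V E G} {u v : V} {vs : List V} {es : List E} {g : G}
    (h : Φ.IsWalk u v vs es g) : ∀ e ∈ es, ∀ x ∈ (Φ.edge e).ends, x ∈ vs ++ [v] := by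
  induction h with
  | nil v => intro e he; cases he
  | @cons e u v w g g' vs es ht hw ih =>
    intro e' he' x hx
    rcases List.mem_cons.1 he' with rfl | he'
    · rw [ht.ends] at hx
      rcases hx with rfl | rfl
      · simp
      · cases hw <;> simp
    · have := ih e' he' x hx
      exact List.mem_cons_of_mem _ this

/-- Splitting a walk at one of its vertices. -/
theorem IsWalk.split {Φ : GainGraph V E G} {u v : V} {vs : List V} {es : List E} {g : G}
    (h : Φ.IsWalk u v vs es g) : ∀ x ∈ vs ++ [v], ∃ vs₁ es₁ g₁ vs₂ es₂ g₂,
      Φ.IsWalk u x vs₁ es₁ g₁ ∧ Φ.IsWalk x v vs₂ es₂ g₂ ∧ vs = vs₁ ++ vs₂ ∧ es = es₁ ++ es₂ ∧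
        g = g₁ * g₂ := by
  induction h with
  | nil v =>
    intro x hx
    obtain rfl : x = v := by simpa using hx
    exact ⟨[], [], 1, [], [], 1, .nil _, .nil _, rfl, rfl, by simp⟩
  | @cons e u v w g g' vs es ht hw ih =>
    intro x hx
    by_cases hxu : x = u
    · subst hxu
      exact ⟨[], [], 1, _, _, _, .nil _, .cons ht hw, rfl, rfl, by simp⟩
    · have hx' : x ∈ vs ++ [w] := by
        rcases List.mem_cons.1 hx with h | h
        · exact absurd h hxu
        · exact h
      obtain ⟨vs₁, es₁, g₁, vs₂, es₂, g₂, h1, h2, rfl, rfl, rfl⟩ := ih x hx'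
      exact ⟨_, _, _, _, _, _, .cons ht h1, h2, rfl, rfl, by simp [mul_assoc]⟩

theorem IsWalk.eq_nil {Φ : GainGraph V E G} {u : V} {vs : List V} {es : List E} {g : G}
    (h : Φ.IsWalk u u vs es g) (hn : (vs ++ [u]).Nodup) : vs = [] ∧ es = [] ∧ g = 1 := by
  cases h with
  | nil => simp
  | cons ht hw => simp at hn

/-- In a balanced edge set every walk can be replaced by a path with the same gain. -/
theorem IsBalanced.exists_path {Φ : GainGraph V E G} {T : Set E} (hT : Φ.IsBalanced T)
    {u v : V} {vs : List V} {es : List E} {g : G}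
    (h : Φ.IsWalk u v vs es g) : (∀ e ∈ es, e ∈ T) → ∃ vs' es', Φ.IsWalk u v vs' es' g ∧
      (∀ e ∈ es', e ∈ T) ∧ (vs' ++ [v]).Nodup ∧ es'.Nodup := by
  induction h with
  | nil v => intro _; exact ⟨[], [], .nil _, by simp, by simp, by simp⟩
  | @cons e u v w g g' vs es ht hw ih =>
    intro hes
    obtain ⟨vs', es', hw', hT', hn, hne⟩ := ih (fun e' h' => hes e' (List.mem_cons_of_mem _ h'))
    have heT : e ∈ T := hes e List.mem_cons_self
    by_cases hu : u ∈ vs' ++ [w]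
    · obtain ⟨vs₁, es₁, g₁, vs₂, es₂, g₂, h1, h2, rfl, rfl, rfl⟩ := hw'.split u hu
      have hn₂ : (vs₂ ++ [w]).Nodup := by
        rw [List.append_assoc] at hn; exact (List.nodup_append.1 hn).2.1
      have hne₂ : es₂.Nodup := (List.nodup_append.1 hne).2.1
      have hne₁ : es₁.Nodup := (List.nodup_append.1 hne).1
      have hu₂ : u ∈ vs₂ ++ [w] := by cases h2 <;> simp
      have hn₁ : (vs₁ ++ [u]).Nodup := by
        rw [List.append_assoc] at hn
        have := List.nodup_append.1 hn
        refine List.nodup_append.2 ⟨this.1, by simp, ?_⟩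
        intro a ha b hb
        obtain rfl : b = u := by simpa using hb
        exact this.2.2 a ha b hu₂
      have key : g * g₁ = 1 := by
        by_cases he : e ∈ es₁
        · cases h1 with
          | nil => cases he
          | @cons e' _ v' _ k k' vs₃ es₃ ht' hw₃ =>
            have hv : v ∉ vs₃ ++ [u] := by
              have : (v :: (vs₃ ++ [u])).Nodup := hn₁
              exact (List.nodup_cons.1 this).1
            have hvu : v ≠ u := fun h => hv (by simp [h])
            rcases List.mem_cons.1 he with rfl | he
            · have hh : v' = u ∧ k = g⁻¹ := by
                rcases ht with h | h <;> rcases ht' with h' | h' <;> rw [h] at h' <;>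
                  injection h' with a b c
                · exact absurd a.symm hvu
                · exact ⟨a.symm, by rw [c, inv_inv]⟩
                · exact ⟨b.symm, c.symm⟩
                · exact absurd b.symm hvu
              obtain ⟨rfl, rfl⟩ := hh
              have hn₃ : (vs₃ ++ [v']).Nodup := by
                have : (v :: (vs₃ ++ [v'])).Nodup := hn₁
                exact (List.nodup_cons.1 this).2
              obtain ⟨-, -, rfl⟩ := hw₃.eq_nil hn₃
              simp
            · exact absurd (hw₃.ends_mem e he v (by rw [ht.ends]; simp)) hv
        · refine hT.2 u _ _ _ (IsWalk.cons ht h1) (by simp) ?_ ?_ ?_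
          · refine List.nodup_cons.2 ⟨?_, (List.nodup_append.1 hn₁).1⟩
            intro hmem
            exact (List.nodup_append.1 hn₁).2.2 u hmem u (by simp) rfl
          · exact List.nodup_cons.2 ⟨he, hne₁⟩
          · intro e' he'
            rcases List.mem_cons.1 he' with rfl | he'
            · exact heT
            · exact hT' e' (by simp [he'])
      refine ⟨vs₂, es₂, ?_, fun e' he' => hT' e' (by simp [he']), hn₂, hne₂⟩
      rw [← mul_assoc, key, one_mul]; exact h2
    · refine ⟨u :: vs', e :: es', .cons ht hw', ?_, ?_, ?_⟩
      · intro e' he'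
        rcases List.mem_cons.1 he' with rfl | he'
        · exact heT
        · exact hT' e' he'
      · exact List.nodup_cons.2 ⟨hu, hn⟩
      · refine List.nodup_cons.2 ⟨fun he => hu ?_, hne⟩
        exact hw'.ends_mem e he u (by rw [ht.ends]; simp)

theorem IsBalanced.closed_walk {Φ : GainGraph V E G} {T : Set E} (hT : Φ.IsBalanced T)
    {u : V} {vs : List V} {es : List E} {g : G}
    (h : Φ.IsWalk u u vs es g) (hes : ∀ e ∈ es, e ∈ T) : g = 1 := by
  obtain ⟨vs', es', h', -, hn, -⟩ := hT.exists_path h hes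
  exact (h'.eq_nil hn).2.2

theorem IsWalk.reverse {Φ : GainGraph V E G} {u v : V} {vs : List V} {es : List E} {g : G}
    (h : Φ.IsWalk u v vs es g) : ∃ vs' es', Φ.IsWalk v u vs' es' g⁻¹ ∧ ∀ e ∈ es', e ∈ es := by
  induction h with
  | nil v => exact ⟨[], [], by simpa using IsWalk.nil v, by simp⟩
  | @cons e u v w g g' vs es ht hw ih =>
    obtain ⟨vs', es', h', hs⟩ := ih
    refine ⟨vs' ++ [v], es' ++ [e], ?_, ?_⟩
    · rw [mul_inv_rev]
      have h1 := h'.append (IsWalk.cons ht.symm (.nil u))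
      rw [mul_one] at h1
      exact h1
    · intro e' he'
      rcases List.mem_append.1 he' with h | h
      · exact List.mem_cons_of_mem _ (hs e' h)
      · simp at h; simp [h]

theorem mem_balancedVerts_iff {Φ : GainGraph V E G} {S : Set E} {v : V} :
    v ∈ Φ.balancedVerts S ↔ Φ.part S v ∈ Φ.balancedParts S := by
  constructor
  · rintro ⟨W, hW, hv⟩
    rw [part_eq_of_mem hW.1 hv]; exact hW
  · intro h; exact ⟨_, h, mem_part_self Φ S v⟩

/-- Two vertices of a component are joined by a walk inside the component. -/
theorem exists_walk {Φ : GainGraph V E G} {S : Set E} {v w : V} (h : (Φ.conn S).r v w) :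
    ∃ vs es g, Φ.IsWalk v w vs es g ∧ ∀ e ∈ es, e ∈ Φ.induced S (Φ.part S w) := by
  induction h with
  | rel x y h =>
    obtain ⟨e, he, g, hg⟩ := h
    refine ⟨_, _, _, .cons (.inl hg) (.nil _), ?_⟩
    intro e' he'
    obtain rfl : e' = e := by simpa using he'
    refine ⟨he, ?_, ?_⟩
    · rw [hg]; exact ⟨x, by simp [EdgeData.ends]⟩
    · rw [hg]
      rintro z (rfl | rfl)
      · rw [← part_eq_of_arc he hg]; exact mem_part_self Φ S _
      · exact mem_part_self Φ S _
  | refl x => exact ⟨_, _, _, .nil _, by simp⟩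
  | symm x y h ih =>
    obtain ⟨vs, es, g, hw, hs⟩ := ih
    obtain ⟨vs', es', h', hs'⟩ := hw.reverse
    have : Φ.part S x = Φ.part S y := part_eq_of_mem (part_mem_parts Φ S y) h
    exact ⟨_, _, _, h', fun e he => this ▸ hs e (hs' e he)⟩
  | trans x y z h h' ih ih' =>
    obtain ⟨vs, es, g, hw, hs⟩ := ih
    obtain ⟨vs', es', g', hw', hs'⟩ := ih'
    have : Φ.part S y = Φ.part S z := part_eq_of_mem (part_mem_parts Φ S z) h'
    refine ⟨_, _, _, hw.append hw', fun e he => ?_⟩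
    rcases List.mem_append.1 he with he | he
    · exact this ▸ hs e he
    · exact hs' e he

/-- A switching function for the balanced components of `S` exists. -/
theorem exists_potential (Φ : GainGraph V E G) (S : Set E) :
    ∃ p : V → G, ∀ e ∈ S, ∀ v w g, Φ.edge e = EdgeData.arc v w g → v ∈ Φ.balancedVerts S →
      (p v)⁻¹ * g * p w = 1 := by
  classical
  have hroot : ∀ W : Set V, ∃ r : V → V, ∀ v, v ∈ W → r v ∈ W ∧ ∀ w ∈ W, r v = r w := by
    intro W
    by_cases hW : W.Nonempty
    · obtain ⟨x, hx⟩ := hW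
      exact ⟨fun _ => x, fun v _ => ⟨hx, fun _ _ => rfl⟩⟩
    · exact ⟨id, fun v hv => absurd ⟨v, hv⟩ hW⟩
  choose r hr using hroot
  let root : V → V := fun v => r (Φ.part S v) v
  have hroot : ∀ v, root v ∈ Φ.part S v := fun v => (hr _ v (mem_part_self Φ S v)).1
  have hex : ∀ v, ∃ g vs es, Φ.IsWalk v (root v) vs es g ∧
      ∀ e ∈ es, e ∈ Φ.induced S (Φ.part S v) := by
    intro v
    obtain ⟨vs, es, g, h, hs⟩ := exists_walk ((Φ.conn S).symm (hroot v))
    have : Φ.part S (root v) = Φ.part S v := part_eq_of_mem (part_mem_parts Φ S v) (hroot v)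
    exact ⟨g, vs, es, h, fun e he => this ▸ hs e he⟩
  choose p vs es hp hs using hex
  refine ⟨p, ?_⟩
  intro e he v w g hg hv
  have hpart : Φ.part S v = Φ.part S w := part_eq_of_arc he hg
  have hrt : root v = root w := by
    have h1 : w ∈ Φ.part S v := hpart ▸ mem_part_self Φ S w
    have := (hr (Φ.part S v) v (mem_part_self Φ S v)).2 w h1
    change r (Φ.part S v) v = r (Φ.part S w) w
    rw [← hpart]; exact this
  have hbal := (mem_balancedVerts_iff.1 hv).2
  obtain ⟨vs', es', hrev, hsub⟩ := (hp v).reverse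
  have hw2 : Φ.IsWalk v (root v) (v :: vs w) (e :: es w) (g * p w) := by
    have := IsWalk.cons (Or.inl hg : Φ.Traverses e v w g) (hp w)
    rw [← hrt] at this
    exact this
  have hcl := hrev.append hw2
  rw [mul_assoc]
  refine hbal.closed_walk hcl ?_
  intro e' he'
  rcases List.mem_append.1 he' with h | h
  · exact hs v e' (hsub e' h)
  · rcases List.mem_cons.1 h with rfl | h
    · refine ⟨he, ?_, ?_⟩
      · rw [hg]; exact ⟨v, by simp [EdgeData.ends]⟩
      · rw [hg]
        rintro z (rfl | rfl)
        · exact mem_part_self Φ S _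
        · rw [hpart]; exact mem_part_self Φ S _
    · rw [hpart]; exact hs w e' h

theorem exists_isTopSwitching [Lattice G] [MulLeftMono G] [MulRightMono G] [Finite V]
    (Φ : GainGraph V E G) (S : Set E) : ∃ η, Φ.IsTopSwitching S η := by
  classical
  obtain ⟨p, hp⟩ := exists_potential Φ S
  have hglb : ∀ W : Set V, ∃ a : G, W.Nonempty → IsGLB (p '' W) a := by
    intro W
    by_cases hW : W.Nonempty
    · have hne : W.toFinite.toFinset.Nonempty := by simpa using hW
      refine ⟨W.toFinite.toFinset.inf' hne p, fun _ => ⟨?_, ?_⟩⟩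
      · rintro _ ⟨x, hx, rfl⟩
        exact Finset.inf'_le _ (by simpa using hx)
      · intro b hb
        refine Finset.le_inf' _ _ fun x hx => hb ⟨x, by simpa using hx, rfl⟩
    · exact ⟨1, fun h => absurd h hW⟩
  choose a ha using hglb
  refine ⟨fun v => if v ∈ Φ.balancedVerts S then p v * (a (Φ.part S v))⁻¹ else 1, ?_, ?_, ?_⟩
  · intro e he v w g hg hv
    have hpart : Φ.part S v = Φ.part S w := part_eq_of_arc he hg
    have hw : w ∈ Φ.balancedVerts S := by
      rw [mem_balancedVerts_iff, ← hpart]; exact mem_balancedVerts_iff.1 hv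
    have h1 := hp e he v w g hg hv
    simp only [hv, hw, if_true, ← hpart, mul_inv_rev, inv_inv]
    calc a (Φ.part S v) * (p v)⁻¹ * g * (p w * (a (Φ.part S v))⁻¹)
        = a (Φ.part S v) * ((p v)⁻¹ * g * p w) * (a (Φ.part S v))⁻¹ := by simp only [mul_assoc]
      _ = 1 := by rw [h1]; simp
  · intro W hW
    have hglb := ha W (nonempty_of_mem_parts hW.1)
    have hval : ∀ v ∈ W, (if v ∈ Φ.balancedVerts S then p v * (a (Φ.part S v))⁻¹ else 1) =
        p v * (a W)⁻¹ := by
      intro v hv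
      rw [if_pos ⟨W, hW, hv⟩, part_eq_of_mem hW.1 hv]
    constructor
    · rintro _ ⟨x, hx, rfl⟩
      simp only [hval x hx]
      exact le_mul_inv_iff_mul_le.2 (by simpa using hglb.1 ⟨x, hx, rfl⟩)
    · intro b hb
      have : b * a W ≤ a W := by
        refine hglb.2 ?_
        rintro _ ⟨x, hx, rfl⟩
        have := hb ⟨x, hx, rfl⟩
        simp only [hval x hx] at this
        exact le_mul_inv_iff_mul_le.1 this
      simpa using this
  · intro v hv
    simp [hv]

theorem IsTopSwitching.unique [Lattice G] [MulLeftMono G] [MulRightMono G]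
    {Φ : GainGraph V E G} {S : Set E} {η η' : V → G}
    (h : Φ.IsTopSwitching S η) (h' : Φ.IsTopSwitching S η') : η = η' := by
  funext v
  by_cases hv : v ∈ Φ.balancedVerts S
  · have hW := mem_balancedVerts_iff.1 hv
    have hconst : ∀ x y, (Φ.conn S).r x y →
        (x ∈ Φ.balancedVerts S ∨ y ∈ Φ.balancedVerts S) →
        (η x)⁻¹ * η' x = (η y)⁻¹ * η' y := by
      intro x y hxy
      induction hxy with
      | rel x y hxy =>
        intro hb
        obtain ⟨e, he, g, hg⟩ := hxy
        have hx : x ∈ Φ.balancedVerts S := by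
          rcases hb with hb | hb
          · exact hb
          · rw [mem_balancedVerts_iff, part_eq_of_arc he hg]; exact mem_balancedVerts_iff.1 hb
        have h1 := h.switching e he x y g hg hx
        have h2 := h'.switching e he x y g hg hx
        have e1 : (η x)⁻¹ = (η y)⁻¹ * g⁻¹ := by
          rw [mul_assoc] at h1; rw [eq_inv_of_mul_eq_one_left h1, mul_inv_rev]
        have e2 : η' x = g * η' y := by
          rw [mul_assoc] at h2; exact (inv_mul_eq_one.1 h2)
        rw [e1, e2]; group
      | refl x => intro _; rfl
      | symm x y _ ih => intro hb; exact (ih hb.symm).symm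
      | trans x y z hxy hyz ih ih' =>
        intro hb
        have p1 : Φ.part S x = Φ.part S y := part_eq_of_mem (part_mem_parts Φ S y) hxy
        have p2 : Φ.part S y = Φ.part S z := part_eq_of_mem (part_mem_parts Φ S z) hyz
        have hy : y ∈ Φ.balancedVerts S := by
          rw [mem_balancedVerts_iff]
          rcases hb with hb | hb
          · rw [← p1]; exact mem_balancedVerts_iff.1 hb
          · rw [p2]; exact mem_balancedVerts_iff.1 hb
        rw [ih (Or.inr hy), ih' (Or.inl hy)]
    have hval : ∀ x ∈ Φ.part S v, η' x = η x * ((η v)⁻¹ * η' v) := by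
      intro x hx
      rw [← hconst x v hx (Or.inr hv)]; group
    set α := (η v)⁻¹ * η' v with hα
    have g1 := h.meet _ hW
    have g2 := h'.meet _ hW
    have le1 : α ≤ 1 := by
      refine g2.2 ?_
      rintro _ ⟨x, hx, rfl⟩
      rw [hval x hx]
      exact le_mul_of_one_le_left' (g1.1 ⟨x, hx, rfl⟩)
    have le2 : α⁻¹ ≤ 1 := by
      refine g1.2 ?_
      rintro _ ⟨x, hx, rfl⟩
      have := g2.1 ⟨x, hx, rfl⟩
      rw [hval x hx] at this
      exact inv_le_iff_one_le_mul.2 this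
    have : α = 1 := le_antisymm le1 (by simpa using le2)
    rw [hα] at this
    exact inv_mul_eq_one.1 this
  · rw [h.off v hv, h'.off v hv]

end Existence

/-- The top switching function `η_S`. -/
noncomputable def topSwitching [Group G] [Lattice G] [MulLeftMono G] [MulRightMono G] [Finite V]
    (Φ : GainGraph V E G) (S : Set E) : V → G :=
  Classical.choose (exists_isTopSwitching Φ S)

/-- The vertex set `π_b(S)` of a contraction by `S`. -/
abbrev ContractVertex [Group G] (Φ : GainGraph V E G) (S : Set E) : Type _ :=
  {W : Set V // W ∈ Φ.balancedParts S}

open Classical in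
/-- The vertex of a contraction by `S` to which `v` is identified, if `v` belongs to a balanced
component of `S`; the other vertices are deleted. -/
noncomputable def contractVertex [Group G] (Φ : GainGraph V E G) (S : Set E) (v : V) :
    Option (Φ.ContractVertex S) :=
  if h : Φ.part S v ∈ Φ.balancedParts S then some ⟨Φ.part S v, h⟩ else none

/-- The contraction `Φ^η / S`: switch by `η`, delete the vertices outside `V_b(S)` (but not the edges
at them), identify each `W ∈ π_b(S)` to a single vertex, and delete `S`. -/
noncomputable def contractWith [Group G] (Φ : GainGraph V E G) (S : Set E) (η : V → G) :
    GainGraph (Φ.ContractVertex S) {e // e ∉ S} G where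
  edge e := ((Φ.switch η).edge e).collapse (Φ.contractVertex S)

/-- The top contraction `Φ / S`. -/
noncomputable def contract [Group G] [Lattice G] [MulLeftMono G] [MulRightMono G] [Finite V]
    (Φ : GainGraph V E G) (S : Set E) : GainGraph (Φ.ContractVertex S) {e // e ∉ S} G :=
  Φ.contractWith S (Φ.topSwitching S)

end GainGraph

/-- A right action of the group `G` on the abelian semigroup `W` by semigroup automorphisms: `h g` is
written `MulOpposite.op g • h`. -/
class GainAction (G : Type*) (W : Type*) [Group G] [AddCommSemigroup W] extends
    MulAction Gᵐᵒᵖ W where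
  op_smul_add : ∀ (g : G) (h h' : W),
    MulOpposite.op g • (h + h') = MulOpposite.op g • h + MulOpposite.op g • h'

/-- The sum of `f` over a nonempty finite set, in an abelian semigroup (which need not have a zero
element): it is computed after adjoining a new zero, which is not the sum of any nonempty family. -/
noncomputable def semigroupSum {V W : Type*} [AddCommSemigroup W] (s : Finset V) (hs : s.Nonempty)
    (f : V → W) : W :=
  WithZero.unzero (x := ∑ v ∈ s, (f v : WithZero W)) (by
    classical
    obtain ⟨a, ha⟩ := hs
    rw [← Finset.add_sum_erase s _ ha]
    cases h : (∑ v ∈ s.erase a, (f v : WithZero W)) with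
    | zero => simp
    | coe b => rw [← WithZero.coe_add]; exact WithZero.coe_ne_zero)

/-- A weighted gain graph `(Φ, h)`, with weights `h : V → W`. -/
structure WeightedGainGraph (V : Type*) (E : Type*) (G : Type*) (W : Type*) extends
    GainGraph V E G where
  weight : V → W

namespace WeightedGainGraph

variable {V E G W : Type*}

/-- Deleting the edge set `S`; the weights do not change. -/
def delete (Φ : WeightedGainGraph V E G W) (S : Set E) : WeightedGainGraph V {e // e ∉ S} G W where
  toGainGraph := Φ.toGainGraph.delete S
  weight := Φ.weight

/-- Switching both the gains and the weights: `h^η(v) = h(v) η(v)`. -/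
def switch [Group G] [AddCommSemigroup W] [GainAction G W] (Φ : WeightedGainGraph V E G W)
    (η : V → G) : WeightedGainGraph V E G W where
  toGainGraph := Φ.toGainGraph.switch η
  weight v := MulOpposite.op (η v) • Φ.weight v

/-- The contraction `(Φ / S, h / S)`, where `h / S (X)` is the sum of `h^{η_S}(v)` over `v ∈ X`. -/
noncomputable def contract [Group G] [Lattice G] [MulLeftMono G] [MulRightMono G]
    [AddCommSemigroup W] [GainAction G W] [Finite V] (Φ : WeightedGainGraph V E G W) (S : Set E) :
    WeightedGainGraph (Φ.ContractVertex S) {e // e ∉ S} G W where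
  toGainGraph := Φ.toGainGraph.contract S
  weight X := semigroupSum (X : Set V).toFinite.toFinset
    (by simpa using GainGraph.nonempty_of_mem_parts X.2.1) (Φ.switch (Φ.topSwitching S)).weight

/-- An isomorphism of weighted gain graphs: bijections of the vertices and of the edges that preserve
the kinds of the edges, the incidences, the gains (even the chosen reference directions) and the
weights. -/
structure Iso {V' E' : Type*} (Φ : WeightedGainGraph V E G W) (Ψ : WeightedGainGraph V' E' G W) where
  vertex : V ≃ V'
  edges : E ≃ E'
  edge_eq : ∀ e, Ψ.edge (edges e) = (Φ.edge e).map vertex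
  weight_eq : ∀ v, Ψ.weight (vertex v) = Φ.weight v

end WeightedGainGraph

/-!
Call `p : V → G` a potential of an edge set on a vertex set `U` if none of its half edges is at `U`,
none of its edges leaves `U`, and switching by `p` gives gain `1` to its edges inside `U`. The
balanced components are the minimal nonempty vertex sets that carry a potential. A potential `q` of
`R` on a vertex set `U` of `Φ / Q` corresponds to the potential `v ↦ η_Q(v) q(X)`, for `v ∈ X ∈ U`,
of `Q ∪ R` on `⋃ U`, and every potential of `Q ∪ R` arises in this way since two potentials of `Q`
on a component of `Q` differ by a constant right factor. Hence `U ↦ ⋃ U` matches the minimal sets.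
By the same rigidity a potential on a component is determined by its meet. As the meet of `η_Q` on
each balanced component of `Q` is `1`, the meet of `η_Q θ` over a component of `Q ∪ R` is that of
`θ`, which gives both factorizations of `η_{Q ∪ R}`: through `Φ / Q` and through the switched graph.
-/

theorem isGLB_image_mul_right {α G : Type*} [Group G] [Preorder G] [MulRightMono G] {f : α → G}
    {s : Set α} {a : G} (h : IsGLB (f '' s) a) (c : G) :
    IsGLB ((fun x => f x * c) '' s) (a * c) := by
  simpa only [Set.image_image, OrderIso.mulRight_apply] using
    (OrderIso.mulRight c).isGLB_image'.2 h

namespace EdgeData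

variable {V V' V'' G : Type*}

theorem map_id (d : EdgeData V G) : d.map id = d := by
  cases d <;> rfl

theorem collapse_map (c : V → Option V') (f : V' → V'') (d : EdgeData V G) :
    (d.collapse c).map f = d.collapse fun v => (c v).map f := by
  cases d with
  | loose => rfl
  | half v => cases hv : c v <;> simp [collapse, map, hv]
  | arc v w g => cases hv : c v <;> cases hw : c w <;> simp [collapse, map, hv, hw]

theorem collapse_collapse (c : V → Option V') (c' : V' → Option V'') (d : EdgeData V G) :
    (d.collapse c).collapse c' = d.collapse fun v => (c v).bind c' := by
  cases d with
  | loose => rfl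
  | half v => cases hv : c v <;> simp [collapse, hv]
  | arc v w g =>
    cases hv : c v <;> cases hw : c w <;> simp only [collapse, hv, hw, Option.bind_some,
      Option.bind_none]
    · cases c' _ <;> rfl
    · cases c' _ <;> rfl

variable [Group G]

theorem switch_switch (η θ : V → G) (d : EdgeData V G) :
    (d.switch η).switch θ = d.switch (η * θ) := by
  cases d <;> simp [switch, mul_assoc]

theorem collapse_switch (c : V → Option V') (θ : V' → G) (d : EdgeData V G) :
    (d.collapse c).switch θ = (d.switch fun v => (c v).elim 1 θ).collapse c := by
  cases d with
  | loose => rfl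
  | half v => cases hv : c v <;> simp [collapse, switch, hv]
  | arc v w g => cases hv : c v <;> cases hw : c w <;> simp [collapse, switch, hv, hw]

theorem switch_collapse_congr {c : V → Option V'} {η θ : V → G} (h : ∀ v, c v ≠ none → η v = θ v)
    (d : EdgeData V G) : (d.switch η).collapse c = (d.switch θ).collapse c := by
  cases d with
  | loose => rfl
  | half v => rfl
  | arc v w g =>
    cases hv : c v <;> cases hw : c w <;> simp [collapse, switch, hv, hw, h]

/-- An edge is neutral on the vertex set `U` for the switching function `p` if it does not join `U`
to its complement, is not a half edge at a vertex of `U`, and, if it is an ordinary edge inside `U`,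
gets gain `1` by switching by `p`. -/
def IsNeutralOn (U : Set V) (p : V → G) : EdgeData V G → Prop
  | loose => True
  | half v => v ∉ U
  | arc v w g => (v ∈ U ↔ w ∈ U) ∧ (v ∈ U → (p v)⁻¹ * g * p w = 1)

theorem IsNeutralOn.congr {U : Set V} {p p' : V → G} {d : EdgeData V G} (h : d.IsNeutralOn U p)
    (hp : U.EqOn p p') : d.IsNeutralOn U p' := by
  cases d with
  | loose => trivial
  | half v => exact h
  | arc v w g => exact ⟨h.1, fun hv => by rw [← hp hv, ← hp (h.1.1 hv)]; exact h.2 hv⟩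

theorem isNeutralOn_switch {U : Set V} {η θ : V → G} {d : EdgeData V G} :
    (d.switch η).IsNeutralOn U θ ↔ d.IsNeutralOn U (η * θ) := by
  cases d <;> simp [switch, IsNeutralOn, mul_assoc]

theorem isNeutralOn_collapse {c : V → Option V'} {U : Set V'} {q : V' → G} {d : EdgeData V G} :
    (d.collapse c).IsNeutralOn U q ↔
      d.IsNeutralOn {v | ∃ x ∈ U, c v = some x} fun v => (c v).elim 1 q := by
  cases d with
  | loose => rfl
  | half v => cases hv : c v <;> simp [collapse, IsNeutralOn, hv]
  | arc v w g =>
    cases hv : c v <;> cases hw : c w <;> simp +contextual [collapse, IsNeutralOn, hv, hw]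

end EdgeData

namespace GainGraph

variable {V E G : Type*}

section Components

variable {Φ : GainGraph V E G} {S : Set E} {W : Set V} {x y : V}

theorem apply_eq_of_conn {β : Type*} {f : V → β} (hf : ∀ ⦃v w⦄, Φ.Adj S v w → f v = f w)
    (h : Φ.conn S x y) : f x = f y :=
  (Setoid.eqvGen_le (s := Setoid.ker f) hf : Φ.conn S ≤ Setoid.ker f) h

theorem conn_of_mem_parts (hW : W ∈ Φ.parts S) (hx : x ∈ W) (hy : y ∈ W) : Φ.conn S x y := by
  obtain ⟨z, rfl⟩ := hW
  exact (Φ.conn S).trans hx ((Φ.conn S).symm hy)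

end Components

section Potentials

variable [Group G] {Φ : GainGraph V E G} {Q S : Set E} {U U' W : Set V} {p p' : V → G}
  {x y : V}

/-- `p` is a potential of `S` on the vertex set `U`: no half edge of `S` is at `U`, no ordinary edge
of `S` leaves `U`, and switching by `p` gives gain `1` to all edges of `S` inside `U`. -/
def IsPotentialOn (Φ : GainGraph V E G) (S : Set E) (U : Set V) (p : V → G) : Prop :=
  ∀ e ∈ S, (Φ.edge e).IsNeutralOn U p

/-- `U` is a union of balanced components of `(V, S)`, expressed by the existence of a potential. -/
def IsBalancedOn (Φ : GainGraph V E G) (S : Set E) (U : Set V) : Prop :=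
  ∃ p, Φ.IsPotentialOn S U p

namespace IsPotentialOn

theorem mono (h : Φ.IsPotentialOn S U p) (hQS : Q ⊆ S) : Φ.IsPotentialOn Q U p :=
  fun e he => h e (hQS he)

theorem congr (h : Φ.IsPotentialOn S U p) (hp : U.EqOn p p') : Φ.IsPotentialOn S U p' :=
  fun e he => (h e he).congr hp

theorem arc {e : E} {v w : V} {g : G} (h : Φ.IsPotentialOn S U p) (he : e ∈ S)
    (hg : Φ.edge e = EdgeData.arc v w g) :
    (v ∈ U ↔ w ∈ U) ∧ (v ∈ U → (p v)⁻¹ * g * p w = 1) := by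
  simpa only [EdgeData.IsNeutralOn, hg] using h e he

theorem mem_iff_of_conn (h : Φ.IsPotentialOn S U p) (hxy : Φ.conn S x y) : x ∈ U ↔ y ∈ U :=
  Iff.of_eq <| apply_eq_of_conn (f := (· ∈ U))
    (fun _ _ ⟨_, he, _, hg⟩ => propext (h.arc he hg).1) hxy

theorem part_subset (h : Φ.IsPotentialOn S U p) (hx : x ∈ U) : Φ.part S x ⊆ U :=
  fun _ hy => (h.mem_iff_of_conn hy).2 hx

theorem inv_mul_eq_of_conn (h : Φ.IsPotentialOn S U p) (h' : Φ.IsPotentialOn S U' p')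
    (hxy : Φ.conn S x y) (hx : x ∈ U) (hx' : x ∈ U') : (p x)⁻¹ * p' x = (p y)⁻¹ * p' y := by
  have hconst : (U ∩ U').mulIndicator (p⁻¹ * p') x = (U ∩ U').mulIndicator (p⁻¹ * p') y := by
    refine apply_eq_of_conn (fun v w ⟨e, he, g, hg⟩ => ?_) hxy
    obtain ⟨hmem, hgain⟩ := h.arc he hg
    obtain ⟨hmem', hgain'⟩ := h'.arc he hg
    by_cases hv : v ∈ U ∩ U'
    · have hpv : p v = g * p w := by rw [← inv_mul_eq_one, ← mul_assoc, hgain hv.1]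
      have hpv' : p' v = g * p' w := by rw [← inv_mul_eq_one, ← mul_assoc, hgain' hv.2]
      have hw : w ∈ U ∩ U' := ⟨hmem.1 hv.1, hmem'.1 hv.2⟩
      simp [Set.mulIndicator_of_mem hv, Set.mulIndicator_of_mem hw, hpv, hpv', mul_assoc]
    · have hw : w ∉ U ∩ U' := fun hw => hv ⟨hmem.2 hw.1, hmem'.2 hw.2⟩
      rw [Set.mulIndicator_of_notMem hv, Set.mulIndicator_of_notMem hw]
  have hy := Set.mem_inter ((h.mem_iff_of_conn hxy).1 hx) ((h'.mem_iff_of_conn hxy).1 hx')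
  rwa [Set.mulIndicator_of_mem (Set.mem_inter hx hx'), Set.mulIndicator_of_mem hy] at hconst

theorem restrict (h : Φ.IsPotentialOn S U p) (hW : W ∈ Φ.parts S) (hWU : W ⊆ U) :
    Φ.IsPotentialOn S W p := by
  intro e he
  have hU := h e he
  cases hd : Φ.edge e with
  | loose => trivial
  | half v =>
    rw [hd] at hU
    exact fun hv => hU (hWU hv)
  | arc v w g =>
    have hvw : v ∈ W ↔ w ∈ W :=
      ⟨fun hv => part_eq_of_mem hW hv ▸ part_eq_of_arc he hd ▸ mem_part_self Φ S w,
        fun hw => part_eq_of_mem hW hw ▸ part_eq_of_arc he hd ▸ mem_part_self Φ S v⟩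
    exact ⟨hvw, fun hv => (h.arc he hd).2 (hWU hv)⟩

theorem gain_eq_of_traverses {e : E} {v w : V} {g : G} (h : Φ.IsPotentialOn S U p) (he : e ∈ S)
    (ht : Φ.Traverses e v w g) (hv : v ∈ U) : g = p v * (p w)⁻¹ := by
  rcases ht with hg | hg
  · have hgain := (h.arc he hg).2 hv
    rwa [mul_assoc, inv_mul_eq_one, eq_comm, ← eq_mul_inv_iff_mul_eq] at hgain
  · have hgain := (h.arc he hg).2 ((h.arc he hg).1.2 hv)
    rwa [mul_assoc, inv_mul_eq_one, eq_inv_mul_iff_mul_eq, ← eq_mul_inv_iff_mul_eq] at hgain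

theorem gain_eq_of_isWalk {v w : V} {vs : List V} {es : List E} {g : G}
    (h : Φ.IsPotentialOn S U p) (hwalk : Φ.IsWalk v w vs es g) :
    (∀ e ∈ es, e ∈ Φ.induced S U) → g = p v * (p w)⁻¹ := by
  induction hwalk with
  | nil v => simp
  | @cons e u v w g g' _ es ht _ ih =>
    intro hes
    obtain ⟨heS, -, hends⟩ := hes e List.mem_cons_self
    have hu : u ∈ U := hends (by simp [ht.ends])
    rw [h.gain_eq_of_traverses heS ht hu, ih fun e' he' => hes e' (List.mem_cons_of_mem _ he')]
    group

theorem isBalanced_induced (h : Φ.IsPotentialOn S U p) : Φ.IsBalanced (Φ.induced S U) := by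
  refine ⟨fun e ⟨he, _, hends⟩ v hv => ?_, fun v vs es g hwalk _ _ _ hes => ?_⟩
  · have hU := h e he
    rw [hv] at hU hends
    exact hU (hends rfl)
  · simpa using h.gain_eq_of_isWalk hwalk hes

end IsPotentialOn

theorem isPotentialOn_switch {η θ : V → G} :
    (Φ.switch η).IsPotentialOn S U θ ↔ Φ.IsPotentialOn S U (η * θ) :=
  forall₂_congr fun _ _ => EdgeData.isNeutralOn_switch

theorem isPotentialOn_balancedVerts (hp : ∀ e ∈ S, ∀ v w g, Φ.edge e = EdgeData.arc v w g →
    v ∈ Φ.balancedVerts S → (p v)⁻¹ * g * p w = 1) :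
    Φ.IsPotentialOn S (Φ.balancedVerts S) p := by
  intro e he
  cases hd : Φ.edge e with
  | loose => trivial
  | half v =>
    intro hv
    refine (mem_balancedVerts_iff.1 hv).2.1 e ⟨he, ?_⟩ v hd
    simp [hd, EdgeData.ends, mem_part_self]
  | arc v w g =>
    refine ⟨?_, hp e he v w g hd⟩
    rw [mem_balancedVerts_iff, mem_balancedVerts_iff, part_eq_of_arc he hd]

theorem isBalancedOn_balancedVerts : Φ.IsBalancedOn S (Φ.balancedVerts S) :=
  (exists_potential Φ S).imp fun _ => isPotentialOn_balancedVerts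

theorem mem_balancedParts_iff_minimal :
    W ∈ Φ.balancedParts S ↔ Minimal (· ∈ {U | U.Nonempty ∧ Φ.IsBalancedOn S U}) W := by
  constructor
  · intro hW
    obtain ⟨p, hp⟩ := isBalancedOn_balancedVerts (Φ := Φ) (S := S)
    refine ⟨⟨nonempty_of_mem_parts hW.1, p, hp.restrict hW.1 (Set.subset_sUnion_of_mem hW)⟩, ?_⟩
    rintro U ⟨⟨x, hx⟩, p', hp'⟩ hUW
    exact part_eq_of_mem hW.1 (hUW hx) ▸ hp'.part_subset hx
  · rintro ⟨⟨⟨x, hx⟩, p, hp⟩, hmin⟩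
    have hpart := hp.part_subset hx
    have hWx : W = Φ.part S x :=
      (hmin ⟨⟨x, mem_part_self Φ S x⟩, p, hp.restrict (part_mem_parts Φ S x) hpart⟩ hpart).antisymm
        hpart
    exact ⟨hWx ▸ part_mem_parts Φ S x, hp.isBalanced_induced⟩

theorem isBalancedOn_of_mem_balancedParts (hW : W ∈ Φ.balancedParts S) : Φ.IsBalancedOn S W :=
  (mem_balancedParts_iff_minimal.1 hW).prop.2

theorem IsBalancedOn.mono (h : Φ.IsBalancedOn S U) (hQS : Q ⊆ S) : Φ.IsBalancedOn Q U :=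
  h.imp fun _ hp => hp.mono hQS

theorem IsBalancedOn.subset_balancedVerts (h : Φ.IsBalancedOn S U) : U ⊆ Φ.balancedVerts S := by
  obtain ⟨p, hp⟩ := h
  intro x hx
  have hpart := part_mem_parts Φ S x
  exact mem_balancedVerts_iff.2
    ⟨hpart, (hp.restrict hpart (hp.part_subset hx)).isBalanced_induced⟩

end Potentials

section TopSwitching

variable [Group G] {Φ : GainGraph V E G} {Q R S : Set E} {U Z : Set V} {η θ p p' : V → G} {a : G}

theorem balancedParts_switch (Φ : GainGraph V E G) (η : V → G) (S : Set E) :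
    (Φ.switch η).balancedParts S = Φ.balancedParts S := by
  have hbal (U : Set V) : (Φ.switch η).IsBalancedOn S U ↔ Φ.IsBalancedOn S U := by
    refine ⟨fun ⟨θ, hθ⟩ => ⟨η * θ, isPotentialOn_switch.1 hθ⟩, fun ⟨p, hp⟩ => ⟨η⁻¹ * p, ?_⟩⟩
    rwa [isPotentialOn_switch, mul_inv_cancel_left]
  ext W
  simp only [mem_balancedParts_iff_minimal, hbal]

variable [Lattice G]

theorem IsTopSwitching.isPotentialOn (h : Φ.IsTopSwitching S η) :
    Φ.IsPotentialOn S (Φ.balancedVerts S) η :=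
  isPotentialOn_balancedVerts h.switching

variable [MulRightMono G]

theorem IsPotentialOn.eqOn_of_isGLB (h : Φ.IsPotentialOn S Z p) (h' : Φ.IsPotentialOn S Z p')
    (hZ : Z ∈ Φ.parts S) (hp : IsGLB (p '' Z) a) (hp' : IsGLB (p' '' Z) a) : Z.EqOn p p' := by
  intro x hx
  have hp'_eq : Z.EqOn p' fun y => p y * ((p x)⁻¹ * p' x) := fun y hy => by
    simp only [h.inv_mul_eq_of_conn h' (conn_of_mem_parts hZ hx hy) hx hx, mul_inv_cancel_left]
  rw [hp'_eq.image_eq] at hp'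
  exact inv_mul_eq_one.1 <| mul_eq_left.1 <| (isGLB_image_mul_right hp _).unique hp'

theorem IsTopSwitching.isGLB_mul_iff (hη : Φ.IsTopSwitching Q η)
    (h : Φ.IsPotentialOn Q U (η * θ)) : IsGLB ((η * θ) '' U) a ↔ IsGLB (θ '' U) a := by
  have hU : U ⊆ Φ.balancedVerts Q := IsBalancedOn.subset_balancedVerts ⟨_, h⟩
  have hpart {x : V} (hx : x ∈ U) : IsGLB ((η * θ) '' Φ.part Q x) (θ x) := by
    have hθ : (Φ.part Q x).EqOn (η * θ) fun y => η y * θ x := fun y hy => by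
      have hxy := hη.isPotentialOn.inv_mul_eq_of_conn h hy (hU (h.part_subset hx hy))
        (h.part_subset hx hy)
      simp only [Pi.mul_apply, inv_mul_cancel_left] at hxy ⊢
      rw [hxy]
    rw [hθ.image_eq]
    have hmeet := hη.meet _ (mem_balancedVerts_iff.1 (hU hx))
    simpa only [one_mul] using isGLB_image_mul_right hmeet (θ x)
  refine isGLB_congr (Set.ext fun b => ⟨?_, ?_⟩)
  · rintro hb _ ⟨x, hx, rfl⟩
    exact (hpart hx).2 (lowerBounds_mono_set (Set.image_mono (h.part_subset hx)) hb)
  · rintro hb _ ⟨x, hx, rfl⟩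
    exact (hb ⟨x, hx, rfl⟩).trans ((hpart hx).1 ⟨x, mem_part_self Φ Q x, rfl⟩)

variable [MulLeftMono G] [Finite V]

theorem isTopSwitching_topSwitching (Φ : GainGraph V E G) (S : Set E) :
    Φ.IsTopSwitching S (Φ.topSwitching S) :=
  Classical.choose_spec (Φ.exists_isTopSwitching S)

theorem isPotentialOn_topSwitching (hZ : Z ∈ Φ.balancedParts S) :
    Φ.IsPotentialOn S Z (Φ.topSwitching S) :=
  (isTopSwitching_topSwitching Φ S).isPotentialOn.restrict hZ.1 (Set.subset_sUnion_of_mem hZ)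

theorem topSwitching_eqOn_mul (hQS : Q ⊆ S) (hZ : Z ∈ Φ.balancedParts S)
    (h : Φ.IsPotentialOn S Z (Φ.topSwitching Q * θ)) (hθ : IsGLB (θ '' Z) 1) :
    Z.EqOn (Φ.topSwitching S) (Φ.topSwitching Q * θ) :=
  (isPotentialOn_topSwitching hZ).eqOn_of_isGLB h hZ.1
    ((isTopSwitching_topSwitching Φ S).meet Z hZ)
    (((isTopSwitching_topSwitching Φ Q).isGLB_mul_iff (h.mono hQS)).2 hθ)

theorem topSwitching_eqOn_mul_topSwitching_switch (hQS : Q ⊆ S) :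
    (Φ.balancedVerts S).EqOn (Φ.topSwitching S)
      (Φ.topSwitching Q * (Φ.switch (Φ.topSwitching Q)).topSwitching S) := by
  rintro v ⟨Z, hZ, hv⟩
  have hZ' : Z ∈ (Φ.switch (Φ.topSwitching Q)).balancedParts S := by rwa [balancedParts_switch]
  exact topSwitching_eqOn_mul hQS hZ (isPotentialOn_switch.1 (isPotentialOn_topSwitching hZ'))
    ((isTopSwitching_topSwitching _ S).meet Z hZ') hv

end TopSwitching

section Delete

variable [Group G] {Φ : GainGraph V E G} {Q R : Set E} {U : Set V} {p : V → G}

theorem isPotentialOn_delete (hdisj : Disjoint Q R) :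
    (Φ.delete R).IsPotentialOn (Subtype.val ⁻¹' Q) U p ↔ Φ.IsPotentialOn Q U p :=
  ⟨fun h e he => h ⟨e, hdisj.notMem_of_mem_left he⟩ he, fun h e he => h e he⟩

theorem balancedParts_delete (hdisj : Disjoint Q R) :
    (Φ.delete R).balancedParts (Subtype.val ⁻¹' Q) = Φ.balancedParts Q := by
  ext W
  simp only [mem_balancedParts_iff_minimal, IsBalancedOn, isPotentialOn_delete hdisj]

theorem topSwitching_delete [Lattice G] [MulLeftMono G] [MulRightMono G] [Finite V]
    (hdisj : Disjoint Q R) :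
    (Φ.delete R).topSwitching (Subtype.val ⁻¹' Q) = Φ.topSwitching Q := by
  have h := isTopSwitching_topSwitching Φ Q
  have hverts : (Φ.delete R).balancedVerts (Subtype.val ⁻¹' Q) = Φ.balancedVerts Q := by
    rw [balancedVerts, balancedParts_delete hdisj, balancedVerts]
  refine (isTopSwitching_topSwitching _ _).unique ⟨fun e he v w g hg hv => ?_, ?_, ?_⟩
  · exact h.switching e he v w g hg (hverts ▸ hv)
  · rw [balancedParts_delete hdisj]
    exact h.meet
  · rw [hverts]
    exact h.off

end Delete

section ContractVertex

variable [Group G] {Φ : GainGraph V E G} {Q R : Set E} {v : V} {X Y : Φ.ContractVertex Q}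

theorem ContractVertex.nonempty (X : Φ.ContractVertex Q) : (X : Set V).Nonempty :=
  nonempty_of_mem_parts X.2.1

theorem ContractVertex.toFinset_nonempty [Finite V] (X : Φ.ContractVertex Q) :
    (X : Set V).toFinite.toFinset.Nonempty :=
  (Set.Finite.toFinset_nonempty _).2 X.nonempty

theorem ContractVertex.subset_balancedVerts (X : Φ.ContractVertex Q) :
    (X : Set V) ⊆ Φ.balancedVerts Q :=
  Set.subset_sUnion_of_mem X.2

theorem ContractVertex.eq_of_mem (hX : v ∈ (X : Set V)) (hY : v ∈ (Y : Set V)) : X = Y :=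
  Subtype.ext ((part_eq_of_mem X.2.1 hX).symm.trans (part_eq_of_mem Y.2.1 hY))

theorem contractVertex_eq_some_iff : Φ.contractVertex Q v = some X ↔ v ∈ (X : Set V) := by
  unfold contractVertex
  split
  next h =>
    have hv : v ∈ ((⟨Φ.part Q v, h⟩ : Φ.ContractVertex Q) : Set V) := mem_part_self Φ Q v
    exact ⟨fun hX => Option.some.inj hX ▸ hv,
      fun hX => congrArg some (ContractVertex.eq_of_mem hv hX)⟩
  next h =>
    exact ⟨nofun, fun hv => absurd (mem_balancedVerts_iff.1 (X.subset_balancedVerts hv)) h⟩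

theorem contractVertex_eq_of_conn {w : V} (h : Φ.conn Q v w) :
    Φ.contractVertex Q v = Φ.contractVertex Q w := by
  refine Option.ext fun X => ?_
  obtain ⟨p, hp⟩ := isBalancedOn_of_mem_balancedParts X.2
  rw [contractVertex_eq_some_iff, contractVertex_eq_some_iff, hp.mem_iff_of_conn h]

/-- The vertices of `Φ / Q`, as vertices of `(Φ \ R) / Q`: deleting edges outside `Q` does not
change the balanced components of `Q`. -/
def deleteVertexEquiv (Φ : GainGraph V E G) (hdisj : Disjoint Q R) :
    Φ.ContractVertex Q ≃ (Φ.delete R).ContractVertex (Subtype.val ⁻¹' Q) :=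
  Equiv.setCongr (balancedParts_delete hdisj).symm

theorem contractVertex_delete (hdisj : Disjoint Q R) (v : V) :
    (Φ.delete R).contractVertex (Subtype.val ⁻¹' Q) v =
      (Φ.contractVertex Q v).map (Φ.deleteVertexEquiv hdisj) := by
  refine Option.ext fun X => ?_
  obtain ⟨X, rfl⟩ := (Φ.deleteVertexEquiv hdisj).surjective X
  simp only [contractVertex_eq_some_iff, Option.map_eq_some_iff,
    (Φ.deleteVertexEquiv hdisj).injective.eq_iff, exists_eq_right]
  rfl

theorem collapse_contractVertex_delete [Lattice G] [MulLeftMono G] [MulRightMono G] [Finite V]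
    (hdisj : Disjoint Q R) (d : EdgeData V G) :
    (d.switch ((Φ.delete R).topSwitching (Subtype.val ⁻¹' Q))).collapse
        ((Φ.delete R).contractVertex (Subtype.val ⁻¹' Q)) =
      ((d.switch (Φ.topSwitching Q)).collapse (Φ.contractVertex Q)).map
        (Φ.deleteVertexEquiv hdisj) := by
  rw [EdgeData.collapse_map, topSwitching_delete hdisj, funext (contractVertex_delete hdisj)]

/-- The set of vertices of `Φ` that are identified to a vertex in `U` by the contraction by `Q`; as
an order embedding, since distinct sets of nonempty disjoint blocks have distinct unions. -/
def ContractVertex.biUnion (Φ : GainGraph V E G) (Q : Set E) :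
    Set (Φ.ContractVertex Q) ↪o Set V :=
  OrderEmbedding.ofMapLEIff (fun U => ⋃ X ∈ U, (X : Set V)) fun U U' => by
    refine ⟨fun h X hX => ?_, fun h => Set.biUnion_subset_biUnion_left h⟩
    obtain ⟨v, hv⟩ := X.nonempty
    obtain ⟨Y, hY, hvY⟩ := Set.mem_iUnion₂.1 (h (Set.mem_biUnion hX hv))
    rwa [X.eq_of_mem hv hvY]

theorem ContractVertex.mem_biUnion {U : Set (Φ.ContractVertex Q)} :
    v ∈ biUnion Φ Q U ↔ ∃ X ∈ U, v ∈ (X : Set V) :=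
  Set.mem_iUnion₂.trans (by simp only [exists_prop])

end ContractVertex

section Contract

open ContractVertex

/-- The function on the vertices of `Φ` that takes the value of `q` at the vertex to which a vertex
is identified by the contraction by `Q`, and the value `1` at the deleted vertices. -/
noncomputable def pullback [Group G] (Φ : GainGraph V E G) (Q : Set E) (q : Φ.ContractVertex Q → G)
    (v : V) : G :=
  (Φ.contractVertex Q v).elim 1 q

variable [Group G] {Φ : GainGraph V E G} {Q R : Set E} {U : Set (Φ.ContractVertex Q)}
  {q : Φ.ContractVertex Q → G} {η : V → G} {v : V}

theorem pullback_of_mem {X : Φ.ContractVertex Q} (hv : v ∈ (X : Set V)) :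
    Φ.pullback Q q v = q X := by
  rw [pullback, contractVertex_eq_some_iff.2 hv, Option.elim_some]

theorem image_pullback_biUnion : Φ.pullback Q q '' biUnion Φ Q U = q '' U := by
  ext g
  constructor
  · rintro ⟨v, hv, rfl⟩
    obtain ⟨X, hX, hvX⟩ := mem_biUnion.1 hv
    exact ⟨X, hX, (pullback_of_mem hvX).symm⟩
  · rintro ⟨X, hX, rfl⟩
    obtain ⟨v, hv⟩ := X.nonempty
    exact ⟨v, mem_biUnion.2 ⟨X, hX, hv⟩, pullback_of_mem hv⟩

theorem isNeutralOn_contractWith_iff {e : {e // e ∉ Q}} :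
    ((Φ.contractWith Q η).edge e).IsNeutralOn U q ↔
      (Φ.edge e).IsNeutralOn (biUnion Φ Q U) (η * Φ.pullback Q q) := by
  have hU : {v | ∃ X ∈ U, Φ.contractVertex Q v = some X} = biUnion Φ Q U := by
    simp only [contractVertex_eq_some_iff, ← mem_biUnion, Set.ofPred_mem_eq]
  exact EdgeData.isNeutralOn_collapse.trans <| by
    rw [switch, EdgeData.isNeutralOn_switch, hU]
    rfl

theorem isPotentialOn_mul_pullback (hη : Φ.IsPotentialOn Q (Φ.balancedVerts Q) η)
    (U : Set (Φ.ContractVertex Q)) (q : Φ.ContractVertex Q → G) :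
    Φ.IsPotentialOn Q (biUnion Φ Q U) (η * Φ.pullback Q q) := by
  intro e he
  have hU : biUnion Φ Q U ⊆ Φ.balancedVerts Q :=
    Set.iUnion₂_subset fun X _ => X.subset_balancedVerts
  have hV := hη e he
  cases hd : Φ.edge e with
  | loose => trivial
  | half v =>
    rw [hd] at hV
    exact fun hv => hV (hU hv)
  | arc v w g =>
    have hvw : Φ.contractVertex Q v = Φ.contractVertex Q w :=
      contractVertex_eq_of_conn (.rel _ _ ⟨e, he, g, hd⟩)
    refine ⟨by simp only [mem_biUnion, ← contractVertex_eq_some_iff, hvw], fun hv => ?_⟩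
    have hgain := (hη.arc he hd).2 (hU hv)
    rw [mul_assoc, inv_mul_eq_one] at hgain
    simp only [Pi.mul_apply, pullback, hvw, hgain]
    group

theorem isPotentialOn_contractWith_iff (hη : Φ.IsPotentialOn Q (Φ.balancedVerts Q) η) :
    (Φ.contractWith Q η).IsPotentialOn (Subtype.val ⁻¹' R) U q ↔
      Φ.IsPotentialOn (Q ∪ R) (biUnion Φ Q U) (η * Φ.pullback Q q) := by
  refine ⟨fun h e he => ?_, fun h e he => isNeutralOn_contractWith_iff.2 (h e (.inr he))⟩
  by_cases heQ : e ∈ Q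
  · exact isPotentialOn_mul_pullback hη U q e heQ
  · exact isNeutralOn_contractWith_iff.1 (h ⟨e, heQ⟩ (he.resolve_left heQ))

theorem isBalancedOn_contractWith_iff (hη : Φ.IsPotentialOn Q (Φ.balancedVerts Q) η) :
    (Φ.contractWith Q η).IsBalancedOn (Subtype.val ⁻¹' R) U ↔
      Φ.IsBalancedOn (Q ∪ R) (biUnion Φ Q U) := by
  refine ⟨fun ⟨q, hq⟩ => ⟨_, (isPotentialOn_contractWith_iff hη).1 hq⟩, fun ⟨p, hp⟩ => ?_⟩
  let root (X : Φ.ContractVertex Q) : V := X.nonempty.some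
  refine ⟨fun X => (η (root X))⁻¹ * p (root X),
    (isPotentialOn_contractWith_iff hη).2 (hp.congr fun v hv => ?_)⟩
  obtain ⟨X, -, hvX⟩ := mem_biUnion.1 hv
  have hroot := hη.inv_mul_eq_of_conn (hp.mono Set.subset_union_left)
    (conn_of_mem_parts X.2.1 hvX X.nonempty.some_mem) (X.subset_balancedVerts hvX) hv
  rw [Pi.mul_apply, pullback_of_mem hvX, ← hroot, mul_inv_cancel_left]

theorem biUnion_setOf_subset {Z : Set V} (hZ : Φ.IsBalancedOn Q Z) :
    biUnion Φ Q {X | (X : Set V) ⊆ Z} = Z := by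
  refine Set.Subset.antisymm (Set.iUnion₂_subset fun X hX => hX) fun v hv => ?_
  obtain ⟨W, hW, hvW⟩ := hZ.subset_balancedVerts hv
  obtain ⟨p, hp⟩ := hZ
  exact mem_biUnion.2 ⟨⟨W, hW⟩, part_eq_of_mem hW.1 hvW ▸ hp.part_subset hv, hvW⟩

theorem biUnion_mem_balancedParts_iff (hη : Φ.IsPotentialOn Q (Φ.balancedVerts Q) η) :
    biUnion Φ Q U ∈ Φ.balancedParts (Q ∪ R) ↔
      U ∈ (Φ.contractWith Q η).balancedParts (Subtype.val ⁻¹' R) := by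
  have hnonempty (Y : Set (Φ.ContractVertex Q)) : (biUnion Φ Q Y).Nonempty ↔ Y.Nonempty := by
    rw [← Set.image_nonempty (f := Φ.pullback Q fun _ => 1), image_pullback_biUnion,
      Set.image_nonempty]
  rw [mem_balancedParts_iff_minimal, mem_balancedParts_iff_minimal,
    OrderEmbedding.minimal_apply_mem_iff fun Z hZ =>
      ⟨_, biUnion_setOf_subset (hZ.2.mono Set.subset_union_left)⟩]
  simp only [Set.mem_ofPred_eq, hnonempty, isBalancedOn_contractWith_iff hη]

theorem biUnion_setOf_subset_of_mem_balancedParts {Z : Set V} (hZ : Z ∈ Φ.balancedParts (Q ∪ R)) :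
    biUnion Φ Q {X | (X : Set V) ⊆ Z} = Z :=
  biUnion_setOf_subset ((isBalancedOn_of_mem_balancedParts hZ).mono Set.subset_union_left)

/-- The correspondence `Y ↦ ⋃ Y` between the vertices of `(Φ / Q) / R` and those of `Φ / (Q ∪ R)`,
for the contraction by `Q` along any potential `η` of `Q`. -/
noncomputable def contractWithVertexEquiv (hη : Φ.IsPotentialOn Q (Φ.balancedVerts Q) η)
    (R : Set E) :
    (Φ.contractWith Q η).ContractVertex (Subtype.val ⁻¹' R) ≃ Φ.ContractVertex (Q ∪ R) where
  toFun Y := ⟨biUnion Φ Q Y, (biUnion_mem_balancedParts_iff hη).2 Y.2⟩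
  invFun Z := ⟨{X | (X : Set V) ⊆ Z}, (biUnion_mem_balancedParts_iff hη).1 <|
    (biUnion_setOf_subset_of_mem_balancedParts Z.2).symm ▸ Z.2⟩
  left_inv Y := Subtype.ext <| (biUnion Φ Q).injective <|
    biUnion_setOf_subset_of_mem_balancedParts ((biUnion_mem_balancedParts_iff hη).2 Y.2)
  right_inv Z := Subtype.ext <| biUnion_setOf_subset_of_mem_balancedParts Z.2

theorem contractVertex_union (hη : Φ.IsPotentialOn Q (Φ.balancedVerts Q) η) (R : Set E) (v : V) :
    Φ.contractVertex (Q ∪ R) v =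
      ((Φ.contractVertex Q v).bind ((Φ.contractWith Q η).contractVertex (Subtype.val ⁻¹' R))).map
        (contractWithVertexEquiv hη R) := by
  refine Option.ext fun Z => ?_
  obtain ⟨Y, rfl⟩ := (contractWithVertexEquiv hη R).surjective Z
  simp only [contractVertex_eq_some_iff, Option.map_eq_some_iff, Option.bind_eq_some_iff,
    (contractWithVertexEquiv hη R).injective.eq_iff, exists_eq_right]
  exact mem_biUnion.trans (exists_congr fun _ => and_comm)

variable [Lattice G] [MulLeftMono G] [MulRightMono G] [Finite V]

theorem topSwitching_union (hU : U ∈ (Φ.contract Q).balancedParts (Subtype.val ⁻¹' R)) :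
    (biUnion Φ Q U).EqOn (Φ.topSwitching (Q ∪ R))
      (Φ.topSwitching Q * Φ.pullback Q ((Φ.contract Q).topSwitching (Subtype.val ⁻¹' R))) := by
  have hη := (isTopSwitching_topSwitching Φ Q).isPotentialOn
  refine topSwitching_eqOn_mul Set.subset_union_left ((biUnion_mem_balancedParts_iff hη).2 hU)
    ((isPotentialOn_contractWith_iff hη).1 (isPotentialOn_topSwitching hU)) ?_
  rw [image_pullback_biUnion]
  exact (isTopSwitching_topSwitching (Φ.contract Q) _).meet U hU

/-- The correspondence `Y ↦ ⋃ Y` between the vertices of the iterated top contraction `(Φ / Q) / R`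
and those of `Φ / (Q ∪ R)`. -/
noncomputable def contractContractVertexEquiv (Φ : GainGraph V E G) (Q R : Set E) :
    (Φ.contract Q).ContractVertex (Subtype.val ⁻¹' R) ≃ Φ.ContractVertex (Q ∪ R) :=
  contractWithVertexEquiv (isTopSwitching_topSwitching Φ Q).isPotentialOn R

theorem collapse_contractVertex_union (d : EdgeData V G) :
    (d.switch (Φ.topSwitching (Q ∪ R))).collapse (Φ.contractVertex (Q ∪ R)) =
      ((((d.switch (Φ.topSwitching Q)).collapse (Φ.contractVertex Q)).switch
        ((Φ.contract Q).topSwitching (Subtype.val ⁻¹' R))).collapse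
        ((Φ.contract Q).contractVertex (Subtype.val ⁻¹' R))).map
        (Φ.contractContractVertexEquiv Q R) := by
  rw [EdgeData.collapse_switch, EdgeData.switch_switch, EdgeData.collapse_collapse,
    EdgeData.collapse_map]
  have hv (v : V) := contractVertex_union (isTopSwitching_topSwitching Φ Q).isPotentialOn R v
  rw [funext hv]
  refine EdgeData.switch_collapse_congr (fun v hne => ?_) d
  obtain ⟨Z, hZ⟩ := Option.ne_none_iff_exists'.1 hne
  obtain ⟨Y, rfl⟩ := (Φ.contractContractVertexEquiv Q R).surjective Z
  rw [← hv, contractVertex_eq_some_iff] at hZ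
  exact topSwitching_union Y.2 hZ

end Contract

section EdgeEquiv

/-- The edges that remain after removing `Q` and then `R` are those outside `Q ∪ R`. -/
def edgesUnionEquiv (Q R : Set E) :
    {e : {e // e ∉ Q} // e ∉ (Subtype.val ⁻¹' R : Set {e // e ∉ Q})} ≃ {e // e ∉ Q ∪ R} where
  toFun e := ⟨e.1.1, fun h => h.elim e.1.2 e.2⟩
  invFun e := ⟨⟨e.1, fun h => e.2 (.inl h)⟩, fun h => e.2 (.inr h)⟩
  left_inv _ := rfl
  right_inv _ := rfl

/-- Two edge sets can be removed in either order. -/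
def edgesSwapEquiv (Q R : Set E) :
    {e : {e // e ∉ Q} // e ∉ (Subtype.val ⁻¹' R : Set {e // e ∉ Q})} ≃
      {e : {e // e ∉ R} // e ∉ (Subtype.val ⁻¹' Q : Set {e // e ∉ R})} where
  toFun e := ⟨⟨e.1.1, e.2⟩, e.1.2⟩
  invFun e := ⟨⟨e.1.1, e.2⟩, e.1.2⟩
  left_inv _ := rfl
  right_inv _ := rfl

end EdgeEquiv

end GainGraph

section SemigroupSum

variable {V W : Type*} [AddCommSemigroup W] {s : Finset V}

theorem coe_semigroupSum (hs : s.Nonempty) (f : V → W) :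
    ((semigroupSum s hs f : W) : WithZero W) = ∑ v ∈ s, (f v : WithZero W) :=
  WithZero.coe_unzero _

theorem semigroupSum_singleton (a : V) (f : V → W) :
    semigroupSum {a} (Finset.singleton_nonempty a) f = f a :=
  WithZero.coe_injective <| by rw [coe_semigroupSum, Finset.sum_singleton]

theorem semigroupSum_cons {a : V} (ha : a ∉ s) (hs : s.Nonempty) (f : V → W) :
    semigroupSum (s.cons a ha) (Finset.cons_nonempty ha) f = f a + semigroupSum s hs f :=
  WithZero.coe_injective <| by
    rw [coe_semigroupSum, Finset.sum_cons, WithZero.coe_add, coe_semigroupSum]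

theorem semigroupSum_congr {t : Finset V} (hst : s = t) (hs : s.Nonempty) (ht : t.Nonempty)
    {f g : V → W} (hfg : ∀ v ∈ t, f v = g v) : semigroupSum s hs f = semigroupSum t ht g :=
  WithZero.coe_injective <| by
    rw [coe_semigroupSum, coe_semigroupSum]
    exact Finset.sum_congr hst fun v hv => congrArg _ (hfg v hv)

theorem semigroupSum_eq_semigroupSum {ι : Type*} {t : Finset ι} {u : ι → Finset V}
    (hdisj : (t : Set ι).PairwiseDisjoint u) (hmem : ∀ v, v ∈ s ↔ ∃ i ∈ t, v ∈ u i)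
    (hs : s.Nonempty) (ht : t.Nonempty) (hu : ∀ i, (u i).Nonempty) (f : V → W) :
    semigroupSum s hs f = semigroupSum t ht fun i => semigroupSum (u i) (hu i) f := by
  obtain rfl : s = t.disjiUnion u hdisj := Finset.ext fun v => by
    rw [hmem, Finset.mem_disjiUnion]
  exact WithZero.coe_injective <| by simp only [coe_semigroupSum, Finset.sum_disjiUnion]

theorem op_smul_semigroupSum {G : Type*} [Group G] [GainAction G W] (g : G) (hs : s.Nonempty)
    (f : V → W) :
    MulOpposite.op g • semigroupSum s hs f =
      semigroupSum s hs fun v => MulOpposite.op g • f v := by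
  induction hs using Finset.Nonempty.cons_induction with
  | singleton a => simp only [semigroupSum_singleton]
  | cons a s ha hs ih => simp only [semigroupSum_cons ha hs, GainAction.op_smul_add, ih]

end SemigroupSum

namespace WeightedGainGraph

section Delete

variable {V E G W : Type*}

/-- The isomorphism `(Φ \ Q) \ R ≅ Φ \ (Q ∪ R)`. -/
def deleteDeleteIso (Φ : WeightedGainGraph V E G W) (Q R : Set E) :
    Iso ((Φ.delete Q).delete (Subtype.val ⁻¹' R)) (Φ.delete (Q ∪ R)) where
  vertex := Equiv.refl V
  edges := GainGraph.edgesUnionEquiv Q R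
  edge_eq _ := (EdgeData.map_id _).symm
  weight_eq _ := rfl

end Delete

section Contract

variable {V E G W : Type*} [Finite V] [Group G] [Lattice G] [MulLeftMono G] [MulRightMono G]
  [AddCommSemigroup W] [GainAction G W]

theorem delete_contract_weight (Φ : WeightedGainGraph V E G W) {Q R : Set E}
    (hdisj : Disjoint Q R) (X : Φ.ContractVertex Q) :
    ((Φ.delete R).contract (Subtype.val ⁻¹' Q)).weight (Φ.deleteVertexEquiv hdisj X) =
      (Φ.contract Q).weight X := by
  refine semigroupSum_congr rfl (Φ.deleteVertexEquiv hdisj X).toFinset_nonempty X.toFinset_nonempty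
    fun v _ => ?_
  exact congrArg (MulOpposite.op · • Φ.weight v)
    (congrFun (GainGraph.topSwitching_delete (Φ := Φ.toGainGraph) hdisj) v)

/-- The isomorphism `(Φ / Q) \ R ≅ (Φ \ R) / Q`, for disjoint `Q` and `R`. -/
noncomputable def contractDeleteIso (Φ : WeightedGainGraph V E G W) {Q R : Set E}
    (hdisj : Disjoint Q R) :
    Iso ((Φ.contract Q).delete (Subtype.val ⁻¹' R))
      ((Φ.delete R).contract (Subtype.val ⁻¹' Q)) where
  vertex := Φ.deleteVertexEquiv hdisj
  edges := GainGraph.edgesSwapEquiv Q R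
  edge_eq e := GainGraph.collapse_contractVertex_delete hdisj (Φ.edge e)
  weight_eq X := Φ.delete_contract_weight hdisj X

theorem contract_union_weight (Φ : WeightedGainGraph V E G W) (Q R : Set E)
    (Y : (Φ.contract Q).ContractVertex (Subtype.val ⁻¹' R)) :
    (Φ.contract (Q ∪ R)).weight (Φ.contractContractVertexEquiv Q R Y) =
      ((Φ.contract Q).contract (Subtype.val ⁻¹' R)).weight Y := by
  have hdisj : ((Y : Set (Φ.ContractVertex Q)).toFinite.toFinset :
      Set (Φ.ContractVertex Q)).PairwiseDisjoint fun X => (X : Set V).toFinite.toFinset :=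
    fun X _ X' _ hne => Finset.disjoint_left.2 fun v hv hv' =>
      hne (GainGraph.ContractVertex.eq_of_mem ((Set.Finite.mem_toFinset _).1 hv)
        ((Set.Finite.mem_toFinset _).1 hv'))
  refine (semigroupSum_eq_semigroupSum hdisj (fun v => ?_)
    (Φ.contractContractVertexEquiv Q R Y).toFinset_nonempty Y.toFinset_nonempty
    (fun X => X.toFinset_nonempty) _).trans ?_
  · simp only [Set.Finite.mem_toFinset]
    exact GainGraph.ContractVertex.mem_biUnion
  refine semigroupSum_congr rfl Y.toFinset_nonempty Y.toFinset_nonempty fun X hX => ?_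
  refine .trans ?_ (op_smul_semigroupSum _ X.toFinset_nonempty _).symm
  refine semigroupSum_congr rfl X.toFinset_nonempty X.toFinset_nonempty fun v hv => ?_
  have hvX : v ∈ (X : Set V) := (Set.Finite.mem_toFinset _).1 hv
  have hη := GainGraph.topSwitching_union Y.2
    (GainGraph.ContractVertex.mem_biUnion.2 ⟨X, (Set.Finite.mem_toFinset _).1 hX, hvX⟩)
  rw [Pi.mul_apply, GainGraph.pullback_of_mem hvX] at hη
  simp only [switch, hη, MulOpposite.op_mul, mul_smul]
  rfl

/-- The isomorphism `(Φ / Q) / R ≅ Φ / (Q ∪ R)`. -/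
noncomputable def contractContractIso (Φ : WeightedGainGraph V E G W) (Q R : Set E) :
    Iso ((Φ.contract Q).contract (Subtype.val ⁻¹' R)) (Φ.contract (Q ∪ R)) where
  vertex := Φ.contractContractVertexEquiv Q R
  edges := GainGraph.edgesUnionEquiv Q R
  edge_eq e := GainGraph.collapse_contractVertex_union (Φ.edge e)
  weight_eq := Φ.contract_union_weight Q R

end Contract

end WeightedGainGraph

theorem propositionP {V E G W : Type*} [Finite V]
    [Group G] [Lattice G] [MulLeftMono G] [MulRightMono G]
    [AddCommSemigroup W] [GainAction G W]
    (Φ : WeightedGainGraph V E G W) (Q R S : Set E) (hdisj : Disjoint Q R) (hS : S = Q ∪ R) :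
    -- `(Φ / Q) / R = Φ / S` with `W'' = {X ∈ π_b(Q) | X ⊆ W}` and `W = ⋃ W''` identified
    (∃ F : WeightedGainGraph.Iso
        ((Φ.contract Q).contract (Subtype.val ⁻¹' R : Set {e // e ∉ Q})) (Φ.contract S),
      (∀ Y, (F.vertex Y : Set V) = ⋃ X ∈ (Y : Set (Φ.ContractVertex Q)), (X : Set V)) ∧
      (∀ Z, ∀ X : Φ.ContractVertex Q, X ∈ (F.vertex.symm Z : Set (Φ.ContractVertex Q)) ↔
        (X : Set V) ⊆ (Z : Set V)) ∧
      (∀ e, ((F.edges e : {e // e ∉ S}) : E) = ((e : {e // e ∉ Q}) : E))) ∧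
    -- `(Φ / Q) \ R = (Φ \ R) / Q`
    (∃ F : WeightedGainGraph.Iso
        ((Φ.contract Q).delete (Subtype.val ⁻¹' R : Set {e // e ∉ Q}))
        ((Φ.delete R).contract (Subtype.val ⁻¹' Q : Set {e // e ∉ R})),
      (∀ X, (F.vertex X : Set V) = (X : Set V)) ∧
      (∀ e, (((F.edges e : {e : {e // e ∉ R} // e ∉ (Subtype.val ⁻¹' Q : Set {e // e ∉ R})}) :
        {e // e ∉ R}) : E) = ((e : {e // e ∉ Q}) : E))) ∧
    -- `(Φ \ Q) \ R = Φ \ S`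
    (∃ F : WeightedGainGraph.Iso
        ((Φ.delete Q).delete (Subtype.val ⁻¹' R : Set {e // e ∉ Q})) (Φ.delete S),
      (∀ v, F.vertex v = v) ∧
      (∀ e, ((F.edges e : {e // e ∉ S}) : E) = ((e : {e // e ∉ Q}) : E))) ∧
    -- `η_S = η_Q η'_S`, where `η'_S` is the top switching function for `S` in `Φ` switched by `η_Q`
    (∀ v ∈ Φ.balancedVerts S, Φ.topSwitching S v =
      Φ.topSwitching Q v * (Φ.toGainGraph.switch (Φ.topSwitching Q)).topSwitching S v) := by
  subst hS
  exact ⟨⟨Φ.contractContractIso Q R, fun _ => rfl, fun _ _ => Iff.rfl, fun _ => rfl⟩,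
    ⟨Φ.contractDeleteIso hdisj, fun _ => rfl, fun _ => rfl⟩,
    ⟨Φ.deleteDeleteIso Q R, fun _ => rfl, fun _ => rfl⟩,
    GainGraph.topSwitching_eqOn_mul_topSwitching_switch Set.subset_union_left⟩
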